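/- For a Euclidean space $E$, or a product of two such spaces with the norm $\|(s,t)\|=\max(\|s\|,\|t\|)$, let $\mathcal B_{\rm loc}(E)$ be the space of locally bounded functions $E\to\mathbb R$ with the metric $\rho(g,h)=\sum_{k\ge1}2^{-k}\min\bigl[1,\sup_{\|x\|\le k}|g(x)-h(x)|\bigr]$ of uniform convergence on compacta. Convergence in distribution $X_n\rightsquigarrow X$ is understood in the sense of Hoffmann-Jørgensen: the $X_n$ are arbitrary (possibly nonmeasurable) maps from probability spaces into a metric space $D$, the limit $X$ is Borel measurable up to a null set, and $\mathbb P^*h(X_n)\to \mathbb P h(X)$ for every bounded continuous $h:D\to\mathbb R$, where $\mathbb P^*$ denotes outer expectation (and outer probability). Theorem 1. For each $n$ let $H_n$ be a random function on $\mathbb R^{d_1}\times\mathbb R^{d_2}$ and let $(s_n,t_n)$ be a (possibly nonmeasurable) random vector in $\mathbb R^{d_1}\times\mathbb R^{d_2}$. Suppose that: (i) $H_n(s,t)=\alpha_n f_n(s)+\beta_n g_n(s,t)$ for all $s,t$, where $f_n$ and $g_n$ are random elements (possibly nonmeasurable) of $\mathcal B_{\rm loc}(\mathbb R^{d_1})$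 and $\mathcal B_{\rm loc}(\mathbb R^{d_1}\times\mathbb R^{d_2})$, and $\alpha_n,\beta_n$ are positive numbers with $\beta_n=o(\alpha_n)$; (ii) $(f_n,g_n)\rightsquigarrow(f,g)$ in $\mathcal B_{\rm loc}(\mathbb R^{d_1})\times\mathcal B_{\rm loc}(\mathbb R^{d_1}\times\mathbb R^{d_2})$, and almost all sample paths of $f$ and $g$ are continuous; (iii) $H_n(s_n,t_n)\le\inf_{s,t}H_n(s,t)+o_p^*(\beta_n)$, that is, $\mathbb P^*\{H_n(s_n,t_n)>\inf_{s,t}H_n(s,t)+\varepsilon\beta_n\}\to0$ for every $\varepsilon>0$; (iv) $\|(s_n,t_n)\|=O_p^*(1)$, that is, for every $\varepsilon>0$ there is $M$ with $\mathbb P^*\{\|(s_n,t_n)\|>M\}\le\varepsilon$ for all large $n$. Suppose that, almost surely, $f(\cdot)$ has a unique minimum, at a random point $s^*$, and $g(s^*,\cdot)$ has a unique minimum, at a random point $t^*$. Then $(s_n,t_n)\rightsquigarrow(s^*,t^*)$. -/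

import Mathlib

open Filter Topology MeasureTheory

namespace MixedRates

/-- Locally bounded real functions on `E`. For `E = ℝ^d` closed balls are compact, so being
locally bounded is the same as being bounded on every ball. -/
@[ext]
structure LocBdd (E : Type*) [NormedAddCommGroup E] where
  toFun : E → ℝ
  bounded' : ∀ R : ℝ, ∃ C : ℝ, ∀ x : E, ‖x‖ ≤ R → |toFun x| ≤ C

namespace LocBdd

variable {E : Type*} [NormedAddCommGroup E]

instance : CoeFun (LocBdd E) (fun _ => E → ℝ) := ⟨LocBdd.toFun⟩

/-- `rhoBall k g h` is the supremum of `|g x - h x|` over `‖x‖ ≤ k`. -/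
noncomputable def rhoBall (k : ℕ) (g h : LocBdd E) : ℝ :=
  ⨆ x : {x : E // ‖x‖ ≤ (k : ℝ)}, |g x.1 - h x.1|

/-- The metric for the topology of uniform convergence on compacta,
`∑_{k ≥ 1} 2^{-k} min (1, rhoBall k g h)`. -/
noncomputable def rho (g h : LocBdd E) : ℝ :=
  ∑' k : ℕ, (1 / 2 : ℝ) ^ (k + 1) * min 1 (rhoBall (k + 1) g h)

theorem bddAbove_rhoBall (k : ℕ) (g h : LocBdd E) :
    BddAbove (Set.range fun x : {x : E // ‖x‖ ≤ (k : ℝ)} => |g x.1 - h x.1|) := by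
  obtain ⟨C, hC⟩ := g.bounded' k
  obtain ⟨D, hD⟩ := h.bounded' k
  refine ⟨C + D, ?_⟩
  rintro _ ⟨x, rfl⟩
  exact (abs_sub _ _).trans (add_le_add (hC _ x.2) (hD _ x.2))

theorem le_rhoBall {k : ℕ} (g h : LocBdd E) {x : E} (hx : ‖x‖ ≤ (k : ℝ)) :
    |g x - h x| ≤ rhoBall k g h :=
  le_ciSup (bddAbove_rhoBall k g h) ⟨x, hx⟩

theorem rhoBall_nonneg (k : ℕ) (g h : LocBdd E) : 0 ≤ rhoBall k g h :=
  Real.iSup_nonneg fun _ => abs_nonneg _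

theorem rhoBall_triangle (k : ℕ) (f g h : LocBdd E) :
    rhoBall k f h ≤ rhoBall k f g + rhoBall k g h :=
  Real.iSup_le (fun x => (abs_sub_le _ (g x.1) _).trans
    (add_le_add (le_rhoBall f g x.2) (le_rhoBall g h x.2)))
    (add_nonneg (rhoBall_nonneg _ _ _) (rhoBall_nonneg _ _ _))

theorem rho_term_nonneg (g h : LocBdd E) (k : ℕ) :
    0 ≤ (1 / 2 : ℝ) ^ (k + 1) * min 1 (rhoBall (k + 1) g h) :=
  mul_nonneg (by positivity) (le_min zero_le_one (rhoBall_nonneg _ _ _))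

theorem summable_rho (g h : LocBdd E) :
    Summable fun k : ℕ => (1 / 2 : ℝ) ^ (k + 1) * min 1 (rhoBall (k + 1) g h) := by
  refine Summable.of_nonneg_of_le (rho_term_nonneg g h) (fun k => ?_)
    ((summable_nat_add_iff 1).2 summable_geometric_two)
  exact mul_le_of_le_one_right (by positivity) (min_le_left _ _)

noncomputable instance : MetricSpace (LocBdd E) where
  dist := rho
  dist_self g := by simp [rho, rhoBall]
  dist_comm g h := by simp [rho, rhoBall, abs_sub_comm]
  dist_triangle f g h := by
    change rho f h ≤ rho f g + rho g h
    unfold rho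
    rw [← (summable_rho f g).tsum_add (summable_rho g h)]
    refine (summable_rho f h).tsum_le_tsum (fun k => ?_)
      ((summable_rho f g).add (summable_rho g h))
    rw [← mul_add]
    refine mul_le_mul_of_nonneg_left ?_ (by positivity)
    have h1 := rhoBall_triangle (k + 1) f g h
    have h2 := rhoBall_nonneg (k + 1) f g
    have h3 := rhoBall_nonneg (k + 1) g h
    rcases le_total 1 (rhoBall (k + 1) f g) with h4 | h4 <;>
    rcases le_total 1 (rhoBall (k + 1) g h) with h5 | h5 <;>
    simp only [min_eq_left, min_eq_right, h4, h5] <;>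
    first
      | exact (min_le_left _ _).trans (by linarith)
      | exact (min_le_right _ _).trans (by linarith)
  eq_of_dist_eq_zero := by
    intro g h hgh
    change rho g h = 0 at hgh
    have hs := (summable_rho g h).hasSum
    rw [show (∑' k : ℕ, (1 / 2 : ℝ) ^ (k + 1) * min 1 (rhoBall (k + 1) g h)) = 0 from hgh] at hs
    have h0 := (hasSum_zero_iff_of_nonneg (rho_term_nonneg g h)).1 hs
    ext x
    obtain ⟨k, hk⟩ := exists_nat_ge ‖x‖
    have h1 := congrFun h0 k
    have h2 : rhoBall (k + 1) g h = 0 := by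
      have h3 : min 1 (rhoBall (k + 1) g h) = 0 := by simpa using h1
      rcases min_choice 1 (rhoBall (k + 1) g h) with h4 | h4
      · rw [h4] at h3; exact absurd h3 one_ne_zero
      · rwa [h4] at h3
    have hk' : ‖x‖ ≤ ((k + 1 : ℕ) : ℝ) := by push_cast; linarith
    have h6 := le_rhoBall g h hk'
    rw [h2] at h6
    exact sub_eq_zero.1 (abs_nonpos_iff.1 h6)

end LocBdd

/-- Outer expectation of a bounded, possibly nonmeasurable, real function `T`: the infimum of
`∫ U ∂μ` over measurable integrable `U ≥ T`. -/
noncomputable def outerExp {Ω : Type*} [MeasurableSpace Ω] (μ : Measure Ω) (T : Ω → ℝ) : ℝ :=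
  sInf {I : ℝ | ∃ U : Ω → ℝ, Measurable U ∧ Integrable U μ ∧ (∀ ω, T ω ≤ U ω) ∧ I = ∫ ω, U ω ∂μ}

/-- Convergence in distribution in the sense of Hoffmann-Jørgensen: the maps `X n` are arbitrary
(possibly nonmeasurable, each on its own probability space), the limit `Y` is Borel measurable up
to a null set, and outer expectations of bounded continuous functions converge. -/
structure WeakConv {D : Type*} [TopologicalSpace D]
    {Ω : ℕ → Type*} [∀ n, MeasurableSpace (Ω n)] (μ : ∀ n, Measure (Ω n))
    {Ω' : Type*} [MeasurableSpace Ω'] (ν : Measure Ω')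
    (X : ∀ n, Ω n → D) (Y : Ω' → D) : Prop where
  aemeasurable : @AEMeasurable Ω' D (borel D) _ Y ν
  tendsto : ∀ h : BoundedContinuousFunction D ℝ,
    Tendsto (fun n => outerExp (μ n) (fun ω => h (X n ω))) atTop (𝓝 (∫ ω, h (Y ω) ∂ν))

/-- `X n = O_p^*(1)`: stochastic boundedness in outer probability. (The value of a `Measure` at a
nonmeasurable set is its outer measure.) -/
def BoundedInOuterProb {E : Type*} [NormedAddCommGroup E]
    {Ω : ℕ → Type*} [∀ n, MeasurableSpace (Ω n)] (μ : ∀ n, Measure (Ω n))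
    (X : ∀ n, Ω n → E) : Prop :=
  ∀ ε : ENNReal, 0 < ε → ∃ M : ℝ, ∀ᶠ n in atTop, μ n {ω | M < ‖X n ω‖} ≤ ε

/-- `H n (x n) ≤ inf H n + o_p^*(β n)`: for every `ε > 0` the outer probability of
`{H n (x n) > inf H n + ε * β n}` tends to `0` (the infimum may be `-∞`). -/
def ApproxMinimizer {E : Type*}
    {Ω : ℕ → Type*} [∀ n, MeasurableSpace (Ω n)] (μ : ∀ n, Measure (Ω n))
    (H : ∀ n, Ω n → E → ℝ) (x : ∀ n, Ω n → E) (β : ℕ → ℝ) : Prop :=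
  ∀ ε : ℝ, 0 < ε →
    Tendsto (fun n => μ n {ω | ∃ y : E, H n ω y + ε * β n < H n ω (x n ω)}) atTop (𝓝 0)

/-- `x` is the unique minimum point of `h`. -/
def IsUniqueMin {E : Type*} (h : E → ℝ) (x : E) : Prop :=
  ∀ y : E, y ≠ x → h x < h y

end MixedRates

/-!
By the portmanteau theorem and tightness it suffices to show
`limsup P*{x_n ∈ K} ≤ P{x* ∈ K}` for compact `K`, where `x_n = (s_n, t_n)` and `x* = (s*, t*)`.
On a ball, where `g_n` is bounded in probability, `β_n = o(α_n)` forces a near-minimizer `x_n` of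
`α_n f_n + β_n g_n` to be a near-minimizer of `f_n` in its first coordinate; comparing with points
having the same first coordinate `s_n`, where the terms `α_n f_n` cancel, it nearly minimizes
`g_n(s_n, ·)` in its second. So `x_n ∈ K` puts `(f_n, g_n)` in the set of pairs having an
approximate lexicographic minimizer in `K`. The closures of these sets decrease, as the tolerance
goes to `0` and the ball grows, to a set which for the limit `(f, g)` is the event `x* ∈ K`. This
yields both the measurability of `x*` and, by the closed-set half of the portmanteau theorem for
`(f_n, g_n) ⇝ (f, g)`, the bound on the `limsup`.
-/

namespace MixedRates

section OuterExpectation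

variable {Ω : Type*} [MeasurableSpace Ω] {μ : Measure Ω} [IsFiniteMeasure μ] {T : Ω → ℝ} {C : ℝ}

theorem outerExp_le_integral (hT : ∀ ω, C ≤ T ω) {U : Ω → ℝ} (hU : Measurable U)
    (hUi : Integrable U μ) (hTU : ∀ ω, T ω ≤ U ω) : outerExp μ T ≤ ∫ ω, U ω ∂μ := by
  refine csInf_le ⟨∫ _, C ∂μ, ?_⟩ ⟨U, hU, hUi, hTU, rfl⟩
  rintro _ ⟨V, -, hVi, hTV, rfl⟩
  exact integral_mono (integrable_const C) hVi fun ω => (hT ω).trans (hTV ω)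

theorem le_outerExp (hT : ∀ ω, T ω ≤ C) {a : ℝ}
    (ha : ∀ U : Ω → ℝ, Measurable U → Integrable U μ → (∀ ω, T ω ≤ U ω) → a ≤ ∫ ω, U ω ∂μ) :
    a ≤ outerExp μ T := by
  refine le_csInf ⟨_, fun _ => C, measurable_const, integrable_const C, hT, rfl⟩ ?_
  rintro _ ⟨U, hU, hUi, hTU, rfl⟩
  exact ha U hU hUi hTU

theorem neg_outerExp_neg_le (hT : ∀ ω, |T ω| ≤ C) :
    -outerExp μ (fun ω => -T ω) ≤ outerExp μ T := by
  refine le_outerExp (fun ω => le_of_abs_le (hT ω)) fun U _ hUi hTU => neg_le.1 ?_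
  refine le_outerExp (fun ω => neg_le.1 (neg_le_of_abs_le (hT ω))) fun V _ hVi hTV => ?_
  rw [← integral_neg]
  exact integral_mono hUi.neg hVi fun ω => (neg_le_neg (hTU ω)).trans (hTV ω)

theorem measureReal_le_outerExp {A : Set Ω} (hT₀ : ∀ ω, 0 ≤ T ω) (hT : ∀ ω, T ω ≤ C)
    (hA : ∀ ω ∈ A, 1 ≤ T ω) : μ.real A ≤ outerExp μ T := by
  refine le_outerExp hT fun U _ hUi hTU => ?_
  calc μ.real A ≤ μ.real {ω | 1 ≤ U ω} := measureReal_mono fun ω hω => (hA ω hω).trans (hTU ω)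
    _ ≤ ∫ ω, U ω ∂μ := by
      simpa using mul_meas_ge_le_integral_of_nonneg
        (.of_forall fun ω => (hT₀ ω).trans (hTU ω)) hUi 1

end OuterExpectation

section LayerCake

theorem sum_ite_succ_le_eq_floor {k : ℕ} {y : ℝ} (hy₀ : 0 ≤ y) (hy : y ≤ k) :
    ∑ i ∈ Finset.range k, (if (i + 1 : ℝ) ≤ y then (1 : ℝ) else 0) = ⌊y⌋₊ := by
  have hfilter : (Finset.range k).filter (fun i : ℕ => (i + 1 : ℝ) ≤ y) = Finset.range ⌊y⌋₊ := by
    ext i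
    have hi : (i + 1 : ℝ) ≤ y ↔ i < ⌊y⌋₊ := by
      rw [← Nat.succ_le_iff, Nat.le_floor_iff hy₀, Nat.cast_succ]
    have hk : ⌊y⌋₊ ≤ k := Nat.floor_le_of_le hy
    simp only [Finset.mem_filter, Finset.mem_range, hi]
    lia
  rw [Finset.sum_boole, hfilter, Finset.card_range]

theorem add_mul_sum_ite_le {k : ℕ} {a δ x : ℝ} (hδ : 0 < δ) (ha : a ≤ x) (hx : x ≤ a + k * δ) :
    a + δ * ∑ i ∈ Finset.range k, (if (i + 1 : ℝ) ≤ (x - a) / δ then (1 : ℝ) else 0) ≤ x := by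
  have hy : 0 ≤ (x - a) / δ := div_nonneg (sub_nonneg.2 ha) hδ.le
  have hfloor := (le_div_iff₀ hδ).1 (Nat.floor_le hy)
  rw [sum_ite_succ_le_eq_floor hy ((div_le_iff₀ hδ).2 (by linarith))]
  linarith

theorem le_add_add_mul_sum_ite {k : ℕ} {a δ x : ℝ} (hδ : 0 < δ) (ha : a ≤ x)
    (hx : x ≤ a + k * δ) :
    x ≤ a + δ + δ * ∑ i ∈ Finset.range k, (if (i + 1 : ℝ) ≤ (x - a) / δ then (1 : ℝ) else 0) := by
  have hy : 0 ≤ (x - a) / δ := div_nonneg (sub_nonneg.2 ha) hδ.le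
  have hfloor := (div_lt_iff₀ hδ).1 (Nat.lt_floor_add_one ((x - a) / δ))
  rw [sum_ite_succ_le_eq_floor hy ((div_le_iff₀ hδ).2 (by linarith))]
  linarith

variable {Ω : Type*} [MeasurableSpace Ω] {μ : Measure Ω}

theorem integrable_add_mul_sum_indicator [IsFiniteMeasure μ] {B : ℕ → Set Ω}
    (hB : ∀ i, NullMeasurableSet (B i) μ) (a δ : ℝ) (k : ℕ) :
    Integrable (fun ω => a + δ * ∑ i ∈ Finset.range k, (B i).indicator 1 ω) μ :=
  (integrable_const a).add ((integrable_finsetSum _ fun i _ =>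
    (integrable_const 1).indicator₀ (hB i)).const_mul δ)

variable [IsProbabilityMeasure μ]

theorem integral_add_mul_sum_indicator {B : ℕ → Set Ω} (hB : ∀ i, NullMeasurableSet (B i) μ)
    (a δ : ℝ) (k : ℕ) :
    ∫ ω, a + δ * ∑ i ∈ Finset.range k, (B i).indicator 1 ω ∂μ =
      a + δ * ∑ i ∈ Finset.range k, μ.real (B i) := by
  have hBi : ∀ i ∈ Finset.range k, Integrable ((B i).indicator (1 : Ω → ℝ)) μ :=
    fun i _ => (integrable_const 1).indicator₀ (hB i)
  rw [integral_add (integrable_const a) ((integrable_finsetSum _ hBi).const_mul δ),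
    integral_const_mul, integral_finsetSum _ hBi]
  simp [integral_indicator₀ (hB _)]

variable {T : Ω → ℝ} {a δ : ℝ} {k : ℕ}

theorem outerExp_le_sum_measureReal (hδ : 0 < δ) (ha : ∀ ω, a ≤ T ω) (hT : ∀ ω, T ω ≤ a + k * δ) :
    outerExp μ T ≤
      a + δ + δ * ∑ i ∈ Finset.range k, μ.real {ω | (i + 1 : ℝ) ≤ (T ω - a) / δ} := by
  set B : ℕ → Set Ω := fun i => toMeasurable μ {ω | (i + 1 : ℝ) ≤ (T ω - a) / δ}
  have hB : ∀ i, MeasurableSet (B i) := fun i => measurableSet_toMeasurable _ _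
  have hBn : ∀ i, NullMeasurableSet (B i) μ := fun i => (hB i).nullMeasurableSet
  have hTB : ∀ ω, T ω ≤ a + δ + δ * ∑ i ∈ Finset.range k, (B i).indicator 1 ω := fun ω => by
    refine (le_add_add_mul_sum_ite hδ (ha ω) (hT ω)).trans ?_
    gcongr with i
    exact Set.indicator_le_indicator_of_subset (f := (1 : Ω → ℝ))
      (subset_toMeasurable μ {ω | (i + 1 : ℝ) ≤ (T ω - a) / δ}) (fun _ => zero_le_one) ω
  calc outerExp μ T
      ≤ ∫ ω, a + δ + δ * ∑ i ∈ Finset.range k, (B i).indicator 1 ω ∂μ :=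
        outerExp_le_integral ha
          (measurable_const.add (measurable_const.mul
            (Finset.measurable_fun_sum _ fun i _ => measurable_one.indicator (hB i))))
          (integrable_add_mul_sum_indicator hBn _ _ _) hTB
    _ = _ := by
      rw [integral_add_mul_sum_indicator hBn]
      simp only [B, Measure.real, measure_toMeasurable]

theorem add_sum_measureReal_le_integral (hδ : 0 < δ) (hTi : Integrable T μ) (ha : ∀ ω, a ≤ T ω)
    (hT : ∀ ω, T ω ≤ a + k * δ) :
    a + δ * ∑ i ∈ Finset.range k, μ.real {ω | (i + 1 : ℝ) ≤ (T ω - a) / δ} ≤ ∫ ω, T ω ∂μ := by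
  have hB : ∀ i : ℕ, NullMeasurableSet {ω | (i + 1 : ℝ) ≤ (T ω - a) / δ} μ := fun i =>
    nullMeasurableSet_le aemeasurable_const ((hTi.aemeasurable.sub_const a).div_const δ)
  rw [← integral_add_mul_sum_indicator hB]
  exact integral_mono (integrable_add_mul_sum_indicator hB a δ k) hTi
    fun ω => add_mul_sum_ite_le hδ (ha ω) (hT ω)

end LayerCake

section Portmanteau

variable {D : Type*} [TopologicalSpace D]
  {Ω' : Type*} [MeasurableSpace Ω'] {ν : Measure Ω'} {Y : Ω' → D}

theorem nullMeasurableSet_preimage_of_isClosed (hY : @AEMeasurable Ω' D (borel D) _ Y ν)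
    {F : Set D} (hF : IsClosed F) : NullMeasurableSet (Y ⁻¹' F) ν := by
  borelize D
  exact hY.nullMeasurableSet_preimage hF.measurableSet

theorem integrable_boundedContinuousFunction_comp [IsFiniteMeasure ν]
    (hY : @AEMeasurable Ω' D (borel D) _ Y ν) (h : BoundedContinuousFunction D ℝ) :
    Integrable (fun ω => h (Y ω)) ν := by
  borelize D
  exact .of_bound (h.continuous.measurable.comp_aemeasurable hY).aestronglyMeasurable ‖h‖
    (.of_forall fun ω => h.norm_coe_le_norm (Y ω))

theorem eventually_measureReal_lt {Ω : ℕ → Type*} [∀ n, MeasurableSpace (Ω n)]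
    {μ : ∀ n, Measure (Ω n)} [∀ n, IsFiniteMeasure (μ n)] [IsFiniteMeasure ν]
    {A : ∀ n, Set (Ω n)} {B : Set Ω'} {κ : ℝ} (hκ : 0 < κ)
    (h : limsup (fun n => μ n (A n)) atTop ≤ ν B) :
    ∀ᶠ n in atTop, (μ n).real (A n) < ν.real B + κ := by
  have hlt : ν B < ENNReal.ofReal (ν.real B + κ) := by
    rw [ENNReal.lt_ofReal_iff_toReal_lt (measure_ne_top _ _)]
    exact lt_add_of_pos_right _ hκ
  filter_upwards [eventually_lt_of_limsup_lt (h.trans_lt hlt)] with n hn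
  exact (ENNReal.lt_ofReal_iff_toReal_lt (measure_ne_top _ _)).1 hn

variable {Ω : ℕ → Type*} [∀ n, MeasurableSpace (Ω n)] {μ : ∀ n, Measure (Ω n)} {X : ∀ n, Ω n → D}

section FiniteMeasure

variable [IsFiniteMeasure ν] [∀ n, IsFiniteMeasure (μ n)]

theorem WeakConv.limsup_measure_preimage_le_lintegral (h : WeakConv μ ν X Y) {F : Set D}
    {φ : BoundedContinuousFunction D NNReal} (hφ : ∀ x ∈ F, 1 ≤ φ x) :
    limsup (fun n => μ n (X n ⁻¹' F)) atTop ≤ ∫⁻ ω, φ (Y ω) ∂ν := by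
  set ψ : BoundedContinuousFunction D ℝ := φ.comp _ NNReal.isometry_coe.lipschitz
  have hle : ∀ n, μ n (X n ⁻¹' F) ≤ ENNReal.ofReal (outerExp (μ n) fun ω => ψ (X n ω)) :=
    fun n => by
      rw [← ofReal_measureReal]
      exact ENNReal.ofReal_le_ofReal (measureReal_le_outerExp (fun ω => (φ (X n ω)).coe_nonneg)
        (fun ω => le_of_abs_le (ψ.norm_coe_le_norm (X n ω)))
        fun ω hω => NNReal.one_le_coe.2 (hφ _ hω))
  calc limsup (fun n => μ n (X n ⁻¹' F)) atTop
      ≤ limsup (fun n => ENNReal.ofReal (outerExp (μ n) fun ω => ψ (X n ω))) atTop :=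
        limsup_le_limsup (.of_forall hle)
    _ = ENNReal.ofReal (∫ ω, ψ (Y ω) ∂ν) := (ENNReal.tendsto_ofReal (h.tendsto ψ)).limsup_eq
    _ = ∫⁻ ω, φ (Y ω) ∂ν := (lintegral_coe_eq_integral _
        (integrable_boundedContinuousFunction_comp h.aemeasurable ψ)).symm

theorem WeakConv.limsup_measure_preimage_le [HasOuterApproxClosed D] (h : WeakConv μ ν X Y)
    {F : Set D} (hF : IsClosed F) :
    limsup (fun n => μ n (X n ⁻¹' F)) atTop ≤ ν (Y ⁻¹' F) := by
  borelize D
  have hlim := HasOuterApproxClosed.tendsto_lintegral_apprSeq hF (ν.map Y)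
  rw [Measure.map_apply_of_aemeasurable h.aemeasurable hF.measurableSet] at hlim
  refine ge_of_tendsto' hlim fun k => ?_
  rw [lintegral_map' (hF.apprSeq k).measurable_coe_ennreal_comp.aemeasurable h.aemeasurable]
  exact h.limsup_measure_preimage_le_lintegral fun x hx =>
    (HasOuterApproxClosed.apprSeq_apply_eq_one hF k hx).ge

theorem WeakConv.boundedInOuterProb_comp [HasOuterApproxClosed D] (h : WeakConv μ ν X Y)
    {E : Type*} [NormedAddCommGroup E] {φ : D → E} (hφ : Continuous φ) :
    BoundedInOuterProb μ fun n ω => φ (X n ω) := by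
  intro ε hε
  set F : ℕ → Set D := fun m => {x | (m : ℝ) ≤ ‖φ x‖}
  have hF : ∀ m, IsClosed (F m) := fun m => isClosed_le continuous_const hφ.norm
  have hanti : Antitone fun m => Y ⁻¹' F m := fun m₁ m₂ hm =>
    Set.preimage_mono fun x (hx : m₂ ≤ ‖φ x‖) => (Nat.cast_le.2 hm).trans hx
  have hempty : ⋂ m, Y ⁻¹' F m = ∅ := by
    refine Set.eq_empty_of_forall_notMem fun ω hω => ?_
    obtain ⟨m, hm⟩ := exists_nat_gt ‖φ (Y ω)‖
    exact hm.not_ge (Set.mem_iInter.1 hω m)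
  have hlim := tendsto_measure_iInter_atTop (μ := ν)
    (fun m => nullMeasurableSet_preimage_of_isClosed h.aemeasurable (hF m)) hanti
    ⟨0, measure_ne_top _ _⟩
  rw [hempty, measure_empty] at hlim
  obtain ⟨m, hm⟩ := (hlim.eventually_lt_const hε).exists
  refine ⟨m, ?_⟩
  filter_upwards [eventually_lt_of_limsup_lt ((h.limsup_measure_preimage_le (hF m)).trans_lt hm)]
    with n hn
  exact (measure_mono fun ω (hω : (m : ℝ) < ‖φ (X n ω)‖) => hω.le).trans hn.le

end FiniteMeasure

variable [IsProbabilityMeasure ν] [∀ n, IsProbabilityMeasure (μ n)]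

-- Up to an error `δ`, `h` is `-‖h‖` plus `δ` times the number of `i` such that
-- `h ≥ -‖h‖ + (i + 1) δ`, and these superlevel sets are closed.
theorem eventually_outerExp_le_integral_add (hY : @AEMeasurable Ω' D (borel D) _ Y ν)
    (hlimsup : ∀ F : Set D, IsClosed F →
      limsup (fun n => μ n (X n ⁻¹' F)) atTop ≤ ν (Y ⁻¹' F))
    (h : BoundedContinuousFunction D ℝ) {ε : ℝ} (hε : 0 < ε) :
    ∀ᶠ n in atTop, outerExp (μ n) (fun ω => h (X n ω)) ≤ ∫ ω, h (Y ω) ∂ν + ε := by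
  have hδ : 0 < ε / 2 := half_pos hε
  set δ := ε / 2 with hδε
  obtain ⟨k, hk⟩ := exists_nat_ge (2 * ‖h‖ / δ)
  have hlo : ∀ x, -‖h‖ ≤ h x := fun x => neg_le_of_abs_le (h.norm_coe_le_norm x)
  have hhi : ∀ x, h x ≤ -‖h‖ + k * δ := fun x => by
    linarith [le_of_abs_le (h.norm_coe_le_norm x), (div_le_iff₀ hδ).1 hk]
  set F : ℕ → Set D := fun i => {x | (i + 1 : ℝ) ≤ (h x - -‖h‖) / δ}
  have hF : ∀ i, IsClosed (F i) := fun i =>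
    isClosed_le continuous_const ((h.continuous.sub continuous_const).div_const δ)
  have hκ : (0 : ℝ) < 1 / (k + 1) := by positivity
  have hevent : ∀ᶠ n in atTop, ∀ i ∈ Finset.range k,
      (μ n).real (X n ⁻¹' F i) < ν.real (Y ⁻¹' F i) + 1 / (k + 1) :=
    (Filter.eventually_all_finset _).2 fun i _ =>
      eventually_measureReal_lt hκ (hlimsup _ (hF i))
  have hkκ : k * (1 / (k + 1) : ℝ) ≤ 1 := by
    rw [mul_one_div]
    exact div_le_one_of_le₀ (by linarith) (by positivity)
  filter_upwards [hevent] with n hn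
  calc outerExp (μ n) (fun ω => h (X n ω))
      ≤ -‖h‖ + δ + δ * ∑ i ∈ Finset.range k, (μ n).real (X n ⁻¹' F i) :=
        outerExp_le_sum_measureReal hδ (fun _ => hlo _) fun _ => hhi _
    _ ≤ -‖h‖ + δ + δ * ∑ i ∈ Finset.range k, (ν.real (Y ⁻¹' F i) + 1 / (k + 1)) := by
        gcongr with i hi
        exact (hn i hi).le
    _ = -‖h‖ + δ * ∑ i ∈ Finset.range k, ν.real (Y ⁻¹' F i) + δ * (1 + k * (1 / (k + 1))) := by
        rw [Finset.sum_add_distrib, Finset.sum_const, Finset.card_range, nsmul_eq_mul]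
        ring
    _ ≤ ∫ ω, h (Y ω) ∂ν + δ * (1 + 1) := by
        gcongr
        exact add_sum_measureReal_le_integral hδ (integrable_boundedContinuousFunction_comp hY h)
          (fun _ => hlo _) fun _ => hhi _
    _ = ∫ ω, h (Y ω) ∂ν + ε := by rw [hδε]; ring

theorem WeakConv.of_forall_isClosed_limsup_le (hY : @AEMeasurable Ω' D (borel D) _ Y ν)
    (hlimsup : ∀ F : Set D, IsClosed F →
      limsup (fun n => μ n (X n ⁻¹' F)) atTop ≤ ν (Y ⁻¹' F)) : WeakConv μ ν X Y := by
  refine ⟨hY, fun h => Metric.tendsto_nhds.2 fun ε hε => ?_⟩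
  filter_upwards [eventually_outerExp_le_integral_add hY hlimsup h (half_pos hε),
    eventually_outerExp_le_integral_add hY hlimsup (-h) (half_pos hε)] with n hupper hlower
  have hneg := neg_outerExp_neg_le (μ := μ n) fun ω => h.norm_coe_le_norm (X n ω)
  simp only [BoundedContinuousFunction.coe_neg, Pi.neg_apply, integral_neg] at hlower
  rw [Real.dist_eq, abs_lt]
  constructor <;> linarith

end Portmanteau

namespace LocBdd

variable {E : Type*} [NormedAddCommGroup E]

instance : Zero (LocBdd E) := ⟨⟨fun _ => 0, fun _ => ⟨0, by simp⟩⟩⟩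

theorem abs_apply_le_rhoBall {k : ℕ} (g : LocBdd E) {x : E} (hx : ‖x‖ ≤ (k : ℝ)) :
    |g x| ≤ rhoBall k g 0 := by
  have h0 : (0 : LocBdd E) x = 0 := rfl
  simpa only [h0, sub_zero] using le_rhoBall g 0 hx

theorem rhoBall_comm (k : ℕ) (g h : LocBdd E) : rhoBall k g h = rhoBall k h g := by
  simp only [rhoBall, abs_sub_comm]

theorem rhoBall_le_succ (k : ℕ) (g h : LocBdd E) : rhoBall k g h ≤ rhoBall (k + 1) g h :=
  Real.iSup_le (fun x => le_rhoBall g h (x.2.trans (by push_cast; linarith)))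
    (rhoBall_nonneg _ _ _)

theorem tendsto_rhoBall (k : ℕ) (g : LocBdd E) :
    Tendsto (fun h => rhoBall k h g) (𝓝 g) (𝓝 0) := by
  refine Metric.tendsto_nhds.2 fun ε hε => ?_
  have hpos : (0 : ℝ) < (1 / 2) ^ (k + 1) * min 1 ε := by positivity
  filter_upwards [Metric.ball_mem_nhds g hpos] with h hh
  have hterm : (1 / 2 : ℝ) ^ (k + 1) * min 1 (rhoBall (k + 1) h g) ≤ dist h g :=
    (summable_rho h g).le_tsum k fun i _ => rho_term_nonneg h g i
  have hmin : min 1 (rhoBall (k + 1) h g) < min 1 ε :=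
    lt_of_mul_lt_mul_left (hterm.trans_lt hh) (by positivity)
  have hlt : rhoBall (k + 1) h g < ε :=
    ((min_lt_iff.1 hmin).resolve_left (min_le_left _ _).not_gt).trans_le (min_le_right _ _)
  rw [Real.dist_eq, sub_zero, abs_of_nonneg (rhoBall_nonneg _ _ _)]
  exact (rhoBall_le_succ k h g).trans_lt hlt

theorem continuous_rhoBall (k : ℕ) (g₀ : LocBdd E) : Continuous fun g => rhoBall k g g₀ := by
  refine continuous_iff_continuousAt.2 fun g => tendsto_iff_norm_sub_tendsto_zero.2 ?_
  refine squeeze_zero (fun _ => norm_nonneg _) (fun h => ?_) (tendsto_rhoBall k g)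
  have hupper := rhoBall_triangle k h g g₀
  have hlower := rhoBall_triangle k g h g₀
  rw [rhoBall_comm k g h] at hlower
  exact abs_le.2 ⟨by linarith, by linarith⟩

end LocBdd

section UniqueMin

variable {E : Type*} {h : E → ℝ} {x : E}

theorem IsUniqueMin.le (hx : IsUniqueMin h x) (y : E) : h x ≤ h y := by
  rcases eq_or_ne y x with rfl | hyx
  · exact le_rfl
  · exact (hx y hyx).le

theorem IsUniqueMin.eq_of_forall_le {y : E} (hx : IsUniqueMin h x) (hy : ∀ z, h y ≤ h z) : y = x :=
  by_contra fun hyx => (hx y hyx).not_ge (hy x)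

/-- `x` is the unique lexicographic minimum point of `(f, g)`: its first coordinate is the unique
minimum point of `f`, and its second coordinate is that of `g (x.1, ·)`. -/
structure IsUniqueLexMin {F : Type*} (f : E → ℝ) (g : E × F → ℝ) (x : E × F) : Prop where
  fst : IsUniqueMin f x.1
  snd : IsUniqueMin (fun t => g (x.1, t)) x.2

end UniqueMin

section ApproxLexMin

variable {E F : Type*} [NormedAddCommGroup E] [NormedAddCommGroup F]

/-- `x` minimizes the pair `(f, g)` lexicographically over the ball of radius `R`, up to `η`: its
first coordinate nearly minimizes `f`, and its second coordinate nearly minimizes `g (x.1, ·)`. -/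
def IsApproxLexMin (R : ℕ) (η : ℝ) (f : E → ℝ) (g : E × F → ℝ) (x : E × F) : Prop :=
  (∀ s, ‖s‖ ≤ R → f x.1 ≤ f s + η) ∧ ∀ t, ‖t‖ ≤ R → g x ≤ g (x.1, t) + η

/-- The pairs of functions having an approximate lexicographic minimum point in `K`. -/
def approxLexMinSet (K : Set (E × F)) (R : ℕ) (η : ℝ) : Set (LocBdd E × LocBdd (E × F)) :=
  {p | ∃ x ∈ K, IsApproxLexMin R η p.1 p.2 x}

variable {R R' : ℕ} {η η' : ℝ} {f : E → ℝ} {g : E × F → ℝ} {x : E × F} {K : Set (E × F)}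

theorem IsApproxLexMin.mono (h : IsApproxLexMin R η f g x) (hR : R' ≤ R) (hη : η ≤ η') :
    IsApproxLexMin R' η' f g x := by
  have hR' : (R' : ℝ) ≤ R := Nat.cast_le.2 hR
  exact ⟨fun s hs => (h.1 s (hs.trans hR')).trans (by gcongr),
    fun t ht => (h.2 t (ht.trans hR')).trans (by gcongr)⟩

theorem approxLexMinSet_mono (hR : R' ≤ R) (hη : η ≤ η') :
    approxLexMinSet K R η ⊆ approxLexMinSet K R' η' :=
  fun _ ⟨x, hxK, hx⟩ => ⟨x, hxK, hx.mono hR hη⟩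

theorem IsApproxLexMin.of_rhoBall_le {p q : LocBdd E × LocBdd (E × F)} {δ : ℝ}
    (h : IsApproxLexMin R η p.1 p.2 x) (hx : ‖x‖ ≤ R) (h₁ : p.1.rhoBall R q.1 ≤ δ)
    (h₂ : p.2.rhoBall R q.2 ≤ δ) : IsApproxLexMin R (η + 2 * δ) q.1 q.2 x := by
  have hfst {s : E} (hs : ‖s‖ ≤ R) : |p.1 s - q.1 s| ≤ δ := (LocBdd.le_rhoBall _ _ hs).trans h₁
  have hsnd {y : E × F} (hy : ‖y‖ ≤ R) : |p.2 y - q.2 y| ≤ δ :=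
    (LocBdd.le_rhoBall _ _ hy).trans h₂
  have hx₁ : ‖x.1‖ ≤ R := (norm_fst_le x).trans hx
  refine ⟨fun s hs => ?_, fun t ht => ?_⟩
  · linarith [h.1 s hs, (abs_le.1 (hfst hs)).2, (abs_le.1 (hfst hx₁)).1]
  · have hxt : ‖(x.1, t)‖ ≤ R := norm_prod_le_iff.2 ⟨hx₁, ht⟩
    linarith [h.2 t ht, (abs_le.1 (hsnd hxt)).2, (abs_le.1 (hsnd hx)).1]

theorem closure_approxLexMinSet_subset (hK : ∀ x ∈ K, ‖x‖ ≤ R) (hη : η < η') :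
    closure (approxLexMinSet K R η) ⊆ approxLexMinSet K R η' := by
  intro q hq
  have hδ : 0 < (η' - η) / 2 := half_pos (sub_pos.2 hη)
  have hnear : ∀ᶠ p in 𝓝 q, p.1.rhoBall R q.1 < (η' - η) / 2 ∧ p.2.rhoBall R q.2 < (η' - η) / 2 :=
    (((LocBdd.tendsto_rhoBall R q.1).comp continuousAt_fst).eventually_lt_const hδ).and
      (((LocBdd.tendsto_rhoBall R q.2).comp continuousAt_snd).eventually_lt_const hδ)
  obtain ⟨p, ⟨x, hxK, hx⟩, h₁, h₂⟩ :=
    ((mem_closure_iff_frequently.1 hq).and_eventually hnear).exists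
  exact ⟨x, hxK, (hx.of_rhoBall_le (hK x hxK) h₁.le h₂.le).mono le_rfl (by linarith)⟩

theorem isApproxLexMin_of_add_mul_le {a b B : ℝ} (ha : 0 < a) (hb : 0 < b)
    (hmin : ∀ y, a * f x.1 + b * g x ≤ a * f y.1 + b * g y + η * b) (hx : ‖x‖ ≤ R)
    (hB : ∀ y, ‖y‖ ≤ R → |g y| ≤ B) (hab : b / a * (2 * B + η) ≤ η) :
    IsApproxLexMin R η f g x := by
  refine ⟨fun s hs => ?_, fun t _ => ?_⟩
  · have hs₂ : ‖(s, x.2)‖ ≤ R := norm_prod_le_iff.2 ⟨hs, (norm_snd_le x).trans hx⟩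
    have hg : g (s, x.2) - g x ≤ 2 * B := by
      linarith [(abs_le.1 (hB _ hs₂)).2, (abs_le.1 (hB x hx)).1]
    have hf : f x.1 - f s ≤ b / a * (2 * B + η) := by
      rw [div_mul_eq_mul_div, le_div_iff₀ ha]
      have hbg := mul_le_mul_of_nonneg_left hg hb.le
      linarith [hmin (s, x.2)]
    linarith
  · refine le_of_mul_le_mul_left ?_ hb
    linarith [hmin (x.1, t)]

theorem IsUniqueLexMin.isApproxLexMin (h : IsUniqueLexMin f g x) (hη : 0 ≤ η) :
    IsApproxLexMin R η f g x :=
  ⟨fun s _ => le_add_of_le_of_nonneg (h.fst.le s) hη,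
    fun t _ => le_add_of_le_of_nonneg (h.snd.le t) hη⟩

theorem IsUniqueLexMin.eq_of_forall_isApproxLexMin {y : E × F} (h : IsUniqueLexMin f g x)
    (hy : ∀ k : ℕ, IsApproxLexMin k (1 / (k + 1)) f g y) : y = x := by
  have hle {u v : ℝ} (r : ℝ) (huv : ∀ k : ℕ, r ≤ k → u ≤ v + 1 / (k + 1)) : u ≤ v := by
    have hlim : Tendsto (fun k : ℕ => v + 1 / ((k : ℝ) + 1)) atTop (𝓝 v) := by
      simpa using tendsto_one_div_add_atTop_nhds_zero_nat.const_add v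
    exact ge_of_tendsto hlim ((tendsto_natCast_atTop_atTop.eventually_ge_atTop r).mono huv)
  have hy₁ : y.1 = x.1 := h.fst.eq_of_forall_le fun s => hle ‖s‖ fun k hk => (hy k).1 s hk
  refine Prod.ext hy₁ (h.snd.eq_of_forall_le fun t => hle ‖t‖ fun k hk => ?_)
  rw [← hy₁]
  exact (hy k).2 t hk

theorem isClosed_setOf_isApproxLexMin (hf : Continuous f) (hg : Continuous g) (R : ℕ) (η : ℝ) :
    IsClosed {x | IsApproxLexMin R η f g x} := by
  simp only [IsApproxLexMin, Set.ofPred_and, Set.ofPred_forall]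
  refine .inter ?_ ?_ <;> refine isClosed_iInter fun _ => isClosed_iInter fun _ => ?_ <;>
    exact isClosed_le (by fun_prop) (by fun_prop)

theorem IsUniqueLexMin.mem_of_forall_exists_isApproxLexMin (h : IsUniqueLexMin f g x)
    (hf : Continuous f) (hg : Continuous g) (hK : IsCompact K)
    (hex : ∀ k : ℕ, ∃ y ∈ K, IsApproxLexMin k (1 / (k + 1)) f g y) : x ∈ K := by
  have hclosed := isClosed_setOf_isApproxLexMin hf hg
  obtain ⟨y, hy⟩ := IsCompact.nonempty_iInter_of_sequence_nonempty_isCompact_isClosed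
    (fun k : ℕ => K ∩ {y | IsApproxLexMin k (1 / (k + 1)) f g y})
    (fun k => Set.inter_subset_inter_right _ fun y hy =>
      IsApproxLexMin.mono hy k.le_succ (Nat.one_div_le_one_div k.le_succ))
    hex (hK.inter_right (hclosed _ _)) fun k => hK.isClosed.inter (hclosed _ _)
  have hyK := Set.mem_iInter.1 hy
  rw [← h.eq_of_forall_isApproxLexMin fun k => (hyK k).2]
  exact (hyK 0).1

/-- Closed sets decreasing with `k`, whose intersection singles out, among pairs of continuous
functions with a unique lexicographic minimum point, those for which this point lies in the compact
set `K`. -/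
def lexMinApprox (K : Set (E × F)) (k : ℕ) : Set (LocBdd E × LocBdd (E × F)) :=
  closure (approxLexMinSet K k (1 / (k + 1)))

theorem antitone_lexMinApprox (K : Set (E × F)) : Antitone (lexMinApprox K) :=
  fun _ _ hk => closure_mono (approxLexMinSet_mono hk (Nat.one_div_le_one_div hk))

theorem mem_iInter_lexMinApprox_iff (hK : IsCompact K) {p : LocBdd E × LocBdd (E × F)}
    (hp₁ : Continuous p.1) (hp₂ : Continuous p.2) (hx : IsUniqueLexMin p.1 p.2 x) :
    p ∈ ⋂ k, lexMinApprox K k ↔ x ∈ K := by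
  refine ⟨fun hp => ?_, fun hxK => Set.mem_iInter.2 fun k => subset_closure
    ⟨x, hxK, hx.isApproxLexMin Nat.one_div_pos_of_nat.le⟩⟩
  obtain ⟨C, hC⟩ := hK.isBounded.exists_norm_le
  refine hx.mem_of_forall_exists_isApproxLexMin hp₁ hp₂ hK fun k => ?_
  obtain ⟨m, hm⟩ := exists_nat_ge (max C (k + 1))
  have hkm : k < m := Nat.cast_lt.1 ((lt_add_one (k : ℝ)).trans_le ((le_max_right _ _).trans hm))
  obtain ⟨y, hyK, hy⟩ := closure_approxLexMinSet_subset
    (fun x hxK => (hC x hxK).trans ((le_max_left _ _).trans hm))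
    (Nat.one_div_lt_one_div hkm) (Set.mem_iInter.1 hp m)
  exact ⟨y, hyK, hy.mono hkm.le le_rfl⟩

end ApproxLexMin

section Limit

variable {E F : Type*} [NormedAddCommGroup E] [NormedAddCommGroup F]
  {Ω' : Type*} [MeasurableSpace Ω'] {ν : Measure Ω'} {Y : Ω' → LocBdd E × LocBdd (E × F)}
  {x : Ω' → E × F}

theorem preimage_iInter_lexMinApprox_ae_eq
    (hcont : ∀ᵐ ω ∂ν, Continuous (Y ω).1 ∧ Continuous (Y ω).2)
    (hx : ∀ᵐ ω ∂ν, IsUniqueLexMin (Y ω).1 (Y ω).2 (x ω)) {K : Set (E × F)} (hK : IsCompact K) :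
    (⋂ k, Y ⁻¹' lexMinApprox K k : Set Ω') =ᵐ[ν] x ⁻¹' K := by
  filter_upwards [hcont, hx] with ω hω hxω
  rw [← Set.preimage_iInter]
  exact propext (mem_iInter_lexMinApprox_iff hK hω.1 hω.2 hxω)

theorem nullMeasurableSet_preimage_lexMinApprox (hY : @AEMeasurable Ω' _ (borel _) _ Y ν)
    (K : Set (E × F)) (k : ℕ) : NullMeasurableSet (Y ⁻¹' lexMinApprox K k) ν :=
  nullMeasurableSet_preimage_of_isClosed hY isClosed_closure

theorem nullMeasurableSet_preimage_of_isCompact (hY : @AEMeasurable Ω' _ (borel _) _ Y ν)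
    (hcont : ∀ᵐ ω ∂ν, Continuous (Y ω).1 ∧ Continuous (Y ω).2)
    (hx : ∀ᵐ ω ∂ν, IsUniqueLexMin (Y ω).1 (Y ω).2 (x ω)) {K : Set (E × F)} (hK : IsCompact K) :
    NullMeasurableSet (x ⁻¹' K) ν :=
  (NullMeasurableSet.iInter fun k => nullMeasurableSet_preimage_lexMinApprox hY K k).congr
    (preimage_iInter_lexMinApprox_ae_eq hcont hx hK)

theorem tendsto_measure_preimage_lexMinApprox [IsFiniteMeasure ν]
    (hY : @AEMeasurable Ω' _ (borel _) _ Y ν)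
    (hcont : ∀ᵐ ω ∂ν, Continuous (Y ω).1 ∧ Continuous (Y ω).2)
    (hx : ∀ᵐ ω ∂ν, IsUniqueLexMin (Y ω).1 (Y ω).2 (x ω)) {K : Set (E × F)} (hK : IsCompact K) :
    Tendsto (fun k => ν (Y ⁻¹' lexMinApprox K k)) atTop (𝓝 (ν (x ⁻¹' K))) := by
  rw [← measure_congr (preimage_iInter_lexMinApprox_ae_eq hcont hx hK)]
  exact tendsto_measure_iInter_atTop (nullMeasurableSet_preimage_lexMinApprox hY K)
    (fun _ _ hk => Set.preimage_mono (antitone_lexMinApprox K hk)) ⟨0, measure_ne_top _ _⟩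

end Limit

section ProperSpace

variable {E : Type*} [NormedAddCommGroup E] [ProperSpace E]
  {Ω' : Type*} [MeasurableSpace Ω'] {ν : Measure Ω'} {x : Ω' → E}

theorem aemeasurable_borel_of_isCompact
    (h : ∀ K : Set E, IsCompact K → NullMeasurableSet (x ⁻¹' K) ν) :
    @AEMeasurable Ω' E (borel E) _ x ν := by
  borelize E
  have hclosed (C : Set E) (hC : IsClosed C) : NullMeasurableSet (x ⁻¹' C) ν := by
    have hunion : x ⁻¹' C = ⋃ m : ℕ, x ⁻¹' (C ∩ Metric.closedBall 0 m) := by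
      rw [← Set.preimage_iUnion, ← Set.inter_iUnion, Metric.iUnion_closedBall_nat, Set.inter_univ]
    rw [hunion]
    exact .iUnion fun m => h _ ((isCompact_closedBall 0 (m : ℝ)).inter_left hC)
  have hx : @Measurable (NullMeasurableSpace Ω' ν) E _ _ x := measurable_of_isClosed hclosed
  exact NullMeasurable.aemeasurable hx

theorem BoundedInOuterProb.limsup_measure_preimage_le {Ω : ℕ → Type*} [∀ n, MeasurableSpace (Ω n)]
    {μ : ∀ n, Measure (Ω n)} {X : ∀ n, Ω n → E} (hX : BoundedInOuterProb μ X)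
    (h : ∀ K : Set E, IsCompact K → limsup (fun n => μ n (X n ⁻¹' K)) atTop ≤ ν (x ⁻¹' K))
    {C : Set E} (hC : IsClosed C) : limsup (fun n => μ n (X n ⁻¹' C)) atTop ≤ ν (x ⁻¹' C) := by
  refine ENNReal.le_of_forall_pos_le_add fun ε hε _ => ?_
  obtain ⟨M, hM⟩ := hX ε (ENNReal.coe_pos.2 hε)
  set K : Set E := C ∩ Metric.closedBall 0 M
  have hsplit : ∀ᶠ n in atTop, μ n (X n ⁻¹' C) ≤ μ n (X n ⁻¹' K) + ε := by
    filter_upwards [hM] with n hn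
    have hcover : X n ⁻¹' C ⊆ X n ⁻¹' K ∪ {ω | M < ‖X n ω‖} := fun ω hω =>
      (le_or_gt ‖X n ω‖ M).imp (fun hle => ⟨hω, mem_closedBall_zero_iff.2 hle⟩) id
    exact (measure_mono hcover).trans ((measure_union_le _ _).trans (by gcongr))
  calc limsup (fun n => μ n (X n ⁻¹' C)) atTop
      ≤ limsup (fun n => μ n (X n ⁻¹' K) + ε) atTop := limsup_le_limsup hsplit
    _ = limsup (fun n => μ n (X n ⁻¹' K)) atTop + ε :=
        limsup_add_const atTop _ _ (by isBoundedDefault) (by isBoundedDefault)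
    _ ≤ ν (x ⁻¹' K) + ε := by
        gcongr
        exact h K ((isCompact_closedBall 0 M).inter_left hC)
    _ ≤ ν (x ⁻¹' C) + ε := by gcongr; exact Set.inter_subset_left

end ProperSpace

section ApproxMinimizer

variable {E F : Type*} [NormedAddCommGroup E] [NormedAddCommGroup F]
  {Ω : ℕ → Type*} [∀ n, MeasurableSpace (Ω n)] {μ : ∀ n, Measure (Ω n)}
  {P : ∀ n, Ω n → LocBdd E × LocBdd (E × F)} {X : ∀ n, Ω n → E × F} {α β : ℕ → ℝ}

theorem ApproxMinimizer.tendsto_measure_not_isApproxLexMin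
    (hX : ApproxMinimizer μ (fun n ω y => α n * (P n ω).1 y.1 + β n * (P n ω).2 y) X β)
    (hα : ∀ n, 0 < α n) (hβ : ∀ n, 0 < β n) (hβα : Asymptotics.IsLittleO atTop β α) {R : ℕ}
    (hP : BoundedInOuterProb μ fun n ω => (P n ω).2.rhoBall R 0) {η : ℝ} (hη : 0 < η) :
    Tendsto (fun n => μ n {ω | ‖X n ω‖ ≤ R ∧
      ¬ IsApproxLexMin R η (P n ω).1 (P n ω).2 (X n ω)}) atTop (𝓝 0) := by
  refine ENNReal.tendsto_nhds_zero.2 fun ε hε => ?_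
  obtain ⟨B, hB⟩ := hP (ε / 2) (ENNReal.half_pos hε.ne')
  have hratio : ∀ᶠ n in atTop, β n / α n * (2 * B + η) < η := by
    have hlim := hβα.tendsto_div_nhds_zero.mul_const (2 * B + η)
    rw [zero_mul] at hlim
    exact hlim.eventually_lt_const hη
  filter_upwards [hB, ENNReal.tendsto_nhds_zero.1 (hX η hη) (ε / 2) (ENNReal.half_pos hε.ne'),
    hratio] with n hBn hXn hn
  refine (measure_mono (t := {ω | B < ‖(P n ω).2.rhoBall R 0‖} ∪ {ω | ∃ y,
    α n * (P n ω).1 y.1 + β n * (P n ω).2 y + η * β n <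
      α n * (P n ω).1 (X n ω).1 + β n * (P n ω).2 (X n ω)}) ?_).trans <|
    (measure_union_le _ _).trans <| (add_le_add hBn hXn).trans_eq (ENNReal.add_halves ε)
  rintro ω ⟨hXR, hlex⟩
  by_contra! hω
  obtain ⟨hrho, hmin⟩ : ‖(P n ω).2.rhoBall R 0‖ ≤ B ∧ ∀ y,
      α n * (P n ω).1 (X n ω).1 + β n * (P n ω).2 (X n ω) ≤
        α n * (P n ω).1 y.1 + β n * (P n ω).2 y + η * β n := by
    simpa only [Set.mem_union, Set.mem_ofPred_eq, not_or, not_exists, not_lt] using hω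
  exact hlex (isApproxLexMin_of_add_mul_le (hα n) (hβ n) hmin hXR
    (fun y hy => ((P n ω).2.abs_apply_le_rhoBall hy).trans ((le_abs_self _).trans hrho)) hn.le)

variable [∀ n, IsFiniteMeasure (μ n)] {Ω' : Type*} [MeasurableSpace Ω'] {ν : Measure Ω'}
  [IsFiniteMeasure ν] {Y : Ω' → LocBdd E × LocBdd (E × F)} {x : Ω' → E × F}

theorem limsup_measure_preimage_le_of_isCompact (hPY : WeakConv μ ν P Y)
    (hcont : ∀ᵐ ω ∂ν, Continuous (Y ω).1 ∧ Continuous (Y ω).2)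
    (hx : ∀ᵐ ω ∂ν, IsUniqueLexMin (Y ω).1 (Y ω).2 (x ω))
    (hX : ∀ (R : ℕ) (η : ℝ), 0 < η → Tendsto (fun n => μ n {ω | ‖X n ω‖ ≤ R ∧
      ¬ IsApproxLexMin R η (P n ω).1 (P n ω).2 (X n ω)}) atTop (𝓝 0))
    {K : Set (E × F)} (hK : IsCompact K) :
    limsup (fun n => μ n (X n ⁻¹' K)) atTop ≤ ν (x ⁻¹' K) := by
  obtain ⟨C, hC⟩ := hK.isBounded.exists_norm_le
  refine ge_of_tendsto (tendsto_measure_preimage_lexMinApprox hPY.aemeasurable hcont hx hK) ?_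
  filter_upwards [tendsto_natCast_atTop_atTop.eventually_ge_atTop C] with k hk
  set N : ∀ n, Set (Ω n) := fun n =>
    {ω | ‖X n ω‖ ≤ k ∧ ¬ IsApproxLexMin k (1 / (k + 1)) (P n ω).1 (P n ω).2 (X n ω)}
  have hcover : ∀ n, X n ⁻¹' K ⊆ P n ⁻¹' lexMinApprox K k ∪ N n := fun n ω hω => by
    by_cases hlex : IsApproxLexMin k (1 / (k + 1)) (P n ω).1 (P n ω).2 (X n ω)
    · exact .inl (subset_closure ⟨X n ω, hω, hlex⟩)
    · exact .inr ⟨(hC _ hω).trans hk, hlex⟩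
  calc limsup (fun n => μ n (X n ⁻¹' K)) atTop
      ≤ limsup (fun n => μ n (P n ⁻¹' lexMinApprox K k) + μ n (N n)) atTop :=
        limsup_le_limsup (.of_forall fun n =>
          (measure_mono (hcover n)).trans (measure_union_le _ _))
    _ = limsup (fun n => μ n (P n ⁻¹' lexMinApprox K k)) atTop :=
        ENNReal.limsup_add_of_right_tendsto_zero (hX k _ Nat.one_div_pos_of_nat) _
    _ ≤ ν (Y ⁻¹' lexMinApprox K k) := hPY.limsup_measure_preimage_le isClosed_closure

end ApproxMinimizer

end MixedRates

theorem theorem1_general {E F : Type*} [NormedAddCommGroup E] [ProperSpace E]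
    [NormedAddCommGroup F] [ProperSpace F]
    {Ω : ℕ → Type*} [∀ n, MeasurableSpace (Ω n)]
    (μ : ∀ n, Measure (Ω n)) [∀ n, IsProbabilityMeasure (μ n)]
    {Ω' : Type*} [MeasurableSpace Ω'] (ν : Measure Ω') [IsProbabilityMeasure ν]
    (H : ∀ n, Ω n → E × F → ℝ)
    (f_ : ∀ n, Ω n → MixedRates.LocBdd E) (g_ : ∀ n, Ω n → MixedRates.LocBdd (E × F))
    (f : Ω' → MixedRates.LocBdd E) (g : Ω' → MixedRates.LocBdd (E × F))
    (s_ : ∀ n, Ω n → E) (t_ : ∀ n, Ω n → F) (s' : Ω' → E) (t' : Ω' → F)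
    (α β : ℕ → ℝ) (hα : ∀ n, 0 < α n) (hβ : ∀ n, 0 < β n)
    (hβα : Asymptotics.IsLittleO atTop β α)
    (hH : ∀ n ω s t, H n ω (s, t) = α n * f_ n ω s + β n * g_ n ω (s, t))
    (hconv : MixedRates.WeakConv μ ν (fun n ω => (f_ n ω, g_ n ω)) (fun ω => (f ω, g ω)))
    (hcont : ∀ᵐ ω ∂ν, Continuous (f ω) ∧ Continuous (g ω))
    (hmin : MixedRates.ApproxMinimizer μ H (fun n ω => (s_ n ω, t_ n ω)) β)
    (htight : MixedRates.BoundedInOuterProb μ (fun n ω => (s_ n ω, t_ n ω)))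
    (hs' : ∀ᵐ ω ∂ν, MixedRates.IsUniqueMin (f ω) (s' ω))
    (ht' : ∀ᵐ ω ∂ν, MixedRates.IsUniqueMin (fun t => g ω (s' ω, t)) (t' ω)) :
    MixedRates.WeakConv μ ν (fun n ω => (s_ n ω, t_ n ω)) (fun ω => (s' ω, t' ω)) := by
  set P : ∀ n, Ω n → MixedRates.LocBdd E × MixedRates.LocBdd (E × F) := fun n ω => (f_ n ω, g_ n ω)
  set X : ∀ n, Ω n → E × F := fun n ω => (s_ n ω, t_ n ω)
  have hlex : ∀ᵐ ω ∂ν, MixedRates.IsUniqueLexMin (f ω) (g ω) (s' ω, t' ω) := by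
    filter_upwards [hs', ht'] with ω hs ht using ⟨hs, ht⟩
  have hH' : H = fun n ω y => α n * (P n ω).1 y.1 + β n * (P n ω).2 y := by
    funext n ω y
    exact hH n ω y.1 y.2
  rw [hH'] at hmin
  have hbdd (R : ℕ) : MixedRates.BoundedInOuterProb μ fun n ω => (P n ω).2.rhoBall R 0 :=
    hconv.boundedInOuterProb_comp ((MixedRates.LocBdd.continuous_rhoBall R 0).comp continuous_snd)
  have hnear (R : ℕ) (η : ℝ) (hη : 0 < η) : Tendsto (fun n => μ n {ω | ‖X n ω‖ ≤ R ∧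
      ¬ MixedRates.IsApproxLexMin R η (P n ω).1 (P n ω).2 (X n ω)}) atTop (𝓝 0) :=
    hmin.tendsto_measure_not_isApproxLexMin hα hβ hβα (hbdd R) hη
  refine .of_forall_isClosed_limsup_le ?_ fun C hC =>
    htight.limsup_measure_preimage_le (fun K hK => ?_) hC
  · exact MixedRates.aemeasurable_borel_of_isCompact fun K hK =>
      MixedRates.nullMeasurableSet_preimage_of_isCompact hconv.aemeasurable hcont hlex hK
  · exact MixedRates.limsup_measure_preimage_le_of_isCompact hconv hcont hlex hnear hK

theorem theorem1 {d₁ d₂ : ℕ}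
    {Ω : ℕ → Type*} [∀ n, MeasurableSpace (Ω n)]
    (μ : ∀ n, Measure (Ω n)) [∀ n, IsProbabilityMeasure (μ n)]
    {Ω' : Type*} [MeasurableSpace Ω'] (ν : Measure Ω') [IsProbabilityMeasure ν]
    (H : ∀ n, Ω n → EuclideanSpace ℝ (Fin d₁) × EuclideanSpace ℝ (Fin d₂) → ℝ)
    (f_ : ∀ n, Ω n → MixedRates.LocBdd (EuclideanSpace ℝ (Fin d₁)))
    (g_ : ∀ n, Ω n →
      MixedRates.LocBdd (EuclideanSpace ℝ (Fin d₁) × EuclideanSpace ℝ (Fin d₂)))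
    (f : Ω' → MixedRates.LocBdd (EuclideanSpace ℝ (Fin d₁)))
    (g : Ω' → MixedRates.LocBdd (EuclideanSpace ℝ (Fin d₁) × EuclideanSpace ℝ (Fin d₂)))
    (s_ : ∀ n, Ω n → EuclideanSpace ℝ (Fin d₁))
    (t_ : ∀ n, Ω n → EuclideanSpace ℝ (Fin d₂))
    (s' : Ω' → EuclideanSpace ℝ (Fin d₁)) (t' : Ω' → EuclideanSpace ℝ (Fin d₂))
    (α β : ℕ → ℝ) (hα : ∀ n, 0 < α n) (hβ : ∀ n, 0 < β n)
    (hβα : Asymptotics.IsLittleO atTop β α)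
    (hH : ∀ n ω s t, H n ω (s, t) = α n * f_ n ω s + β n * g_ n ω (s, t))
    (hconv : MixedRates.WeakConv μ ν (fun n ω => (f_ n ω, g_ n ω)) (fun ω => (f ω, g ω)))
    (hcont : ∀ᵐ ω ∂ν, Continuous (f ω) ∧ Continuous (g ω))
    (hmin : MixedRates.ApproxMinimizer μ H (fun n ω => (s_ n ω, t_ n ω)) β)
    (htight : MixedRates.BoundedInOuterProb μ (fun n ω => (s_ n ω, t_ n ω)))
    (hs' : ∀ᵐ ω ∂ν, MixedRates.IsUniqueMin (f ω) (s' ω))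
    (ht' : ∀ᵐ ω ∂ν, MixedRates.IsUniqueMin (fun t => g ω (s' ω, t)) (t' ω)) :
    MixedRates.WeakConv μ ν (fun n ω => (s_ n ω, t_ n ω)) (fun ω => (s' ω, t' ω)) :=
  theorem1_general μ ν H f_ g_ f g s_ t_ s' t' α β hα hβ hβα hH hconv hcont hmin htight hs' ht'
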